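/- Let $n\ge 2$, $m\ge 1$, let $\mathbb{R}^n$ carry the Euclidean metric $g_0$ and coordinates $(x_1,\dots,x_n)$, and let $(F^m,g_F)$ be a (nonempty, smooth, boundaryless) $m$-dimensional Riemannian Einstein manifold with constant Ricci curvature $\lambda_F\in\mathbb{R}$, that is, $\mathrm{Ric}_{g_F}=\lambda_F\,g_F$. Let $f,h:\mathbb{R}^n\to\mathbb{R}$ be smooth functions with $f>0$, and let $M=\mathbb{R}^n\times_f F$ be the warped product with metric $g=g_0+f^2g_F$. Assume that $(M,g)$ is a gradient Ricci soliton with potential function $h$ (lifted to $M$) and constant $\rho\in\mathbb{R}$, that is, $$\mathrm{Ric}_g+\mathrm{Hess}_g(h)=\rho\, g \quad\text{on } M,$$ and that $f$ depends only on $x_1$, so that $f(x_1,\dots,x_n)=f(x_1)$ for a function $f$ of one real variable. Then there are a smooth function $h_1:\mathbb{R}\to\mathbb{R}$ and real numbers $a_k,b_k$ $(2\le k\le n)$ such that $$h(x_1,\dots,x_n)=h_1(x_1)+\sum_{k=2}^{n}\Big(\frac{\rho}{2}x_k^2+a_kx_k+b_k\Big)\quad\text{for all } x\in\mathbb{R}^n,$$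 and, on all of $\mathbb{R}$, $$\begin{cases}\lambda_F-ff''-(m-1)(f')^2+ff'h_1'=\rho f^2,\\ fh_1''-mf''=\rho f.\end{cases}$$ -/

import Mathlib

open scoped Manifold ContDiff

set_option maxSynthPendingDepth 3

noncomputable section

namespace WarpedSoliton

/-! ### Local Riemannian geometry in a finite-dimensional vector space -/

section Local

variable {E : Type*} [NormedAddCommGroup E] [NormedSpace ℝ E]

/-- The first Christoffel form at `y` of a field `G` of bilinear forms on `E`:
`(u, v, w) ↦ (1/2) (D_u G (v, w) + D_v G (u, w) - D_w G (u, v))`. -/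
def christoffelLower (G : E → E →L[ℝ] E →L[ℝ] ℝ) (y : E) : E →L[ℝ] E →L[ℝ] E →L[ℝ] ℝ :=
  (1 / 2 : ℝ) • (fderiv ℝ G y + (fderiv ℝ G y).flip -
    ((ContinuousLinearMap.flipₗᵢ ℝ E E ℝ).toContinuousLinearEquiv :
      (E →L[ℝ] E →L[ℝ] ℝ) →L[ℝ] (E →L[ℝ] E →L[ℝ] ℝ)) ∘L (fderiv ℝ G y).flip)

/-- The Christoffel symbol `Γ(u, v)` at `y`, obtained from the first Christoffel form by raising
the last index: `G_y (Γ(u, v), w) = christoffelLower G y u v w` when `G_y` is nondegenerate. -/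
def christoffel (G : E → E →L[ℝ] E →L[ℝ] ℝ) (y : E) : E →L[ℝ] E →L[ℝ] E :=
  (ContinuousLinearMap.compL ℝ E (E →L[ℝ] ℝ) E (G y).inverse) ∘L christoffelLower G y

/-- The curvature endomorphism `u ↦ R(u, v) w` at `y`, where
`R(u, v) w = (D_u Γ)(v, w) - (D_v Γ)(u, w) + Γ(u, Γ(v, w)) - Γ(v, Γ(u, w))`. -/
def curvatureEndo (G : E → E →L[ℝ] E →L[ℝ] ℝ) (y v w : E) : E →L[ℝ] E :=
  ((fderiv ℝ (christoffel G) y).flip v).flip w - (fderiv ℝ (christoffel G) y v).flip w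
    + (christoffel G y).flip (christoffel G y v w)
    - christoffel G y v ∘L (christoffel G y).flip w

/-- The Ricci tensor `Ric(v, w) = tr (u ↦ R(u, v) w)` at `y`. -/
def localRicci (G : E → E →L[ℝ] E →L[ℝ] ℝ) (y v w : E) : ℝ :=
  LinearMap.trace ℝ E (curvatureEndo G y v w : E →ₗ[ℝ] E)

/-- The Hessian `D²k(v, w) - Dk(Γ(v, w))` at `y` of a function `k` with respect to `G`. -/
def localHessian (G : E → E →L[ℝ] E →L[ℝ] ℝ) (k : E → ℝ) (y v w : E) : ℝ :=
  fderiv ℝ (fderiv ℝ k) y v w - fderiv ℝ k y (christoffel G y v w)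

end Local

/-! ### Ricci tensor, Hessian and solitons on a manifold without boundary -/

section Manifold

variable {E : Type*} [NormedAddCommGroup E] [NormedSpace ℝ E]
  {H : Type*} [TopologicalSpace H] (I : ModelWithCorners ℝ E H)
  {M : Type*} [TopologicalSpace M] [ChartedSpace H M]

/-- The expression in the chart around `x` of a field `g` of bilinear forms on `M`
(its pullback by the inverse of the chart). -/
def metricInChart (g : ∀ x : M, TangentSpace I x →L[ℝ] TangentSpace I x →L[ℝ] ℝ) (x : M) (y : E) :
    E →L[ℝ] E →L[ℝ] ℝ :=
  let D : E →L[ℝ] TangentSpace I ((extChartAt I x).symm y) :=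
    mfderiv 𝓘(ℝ, E) I (extChartAt I x).symm y
  ContinuousLinearMap.precomp ℝ D ∘L (g ((extChartAt I x).symm y) ∘L D)

/-- The Ricci tensor at `x` of the metric `g`, computed in the chart around `x`. -/
def ricci (g : ∀ x : M, TangentSpace I x →L[ℝ] TangentSpace I x →L[ℝ] ℝ) (x : M)
    (v w : TangentSpace I x) : ℝ :=
  localRicci (metricInChart I g x) (extChartAt I x x)
    (mfderiv I 𝓘(ℝ, E) (extChartAt I x) x v) (mfderiv I 𝓘(ℝ, E) (extChartAt I x) x w)

/-- The Hessian at `x`, with respect to the metric `g`, of a function `k` on `M`,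
computed in the chart around `x`. -/
def hessian (g : ∀ x : M, TangentSpace I x →L[ℝ] TangentSpace I x →L[ℝ] ℝ) (k : M → ℝ) (x : M)
    (v w : TangentSpace I x) : ℝ :=
  localHessian (metricInChart I g x) (k ∘ (extChartAt I x).symm) (extChartAt I x x)
    (mfderiv I 𝓘(ℝ, E) (extChartAt I x) x v) (mfderiv I 𝓘(ℝ, E) (extChartAt I x) x w)

/-- `g` is Einstein with constant Ricci curvature `c`: `Ric_g = c g`. -/
def IsEinstein (g : ∀ x : M, TangentSpace I x →L[ℝ] TangentSpace I x →L[ℝ] ℝ) (c : ℝ) : Prop :=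
  ∀ (x : M) (v w : TangentSpace I x), ricci I g x v w = c * g x v w

/-- `(M, g)` is a gradient Ricci soliton with potential `k` and constant `ρ`:
`Ric_g + Hess_g k = ρ g`. -/
def IsGradientRicciSoliton (g : ∀ x : M, TangentSpace I x →L[ℝ] TangentSpace I x →L[ℝ] ℝ)
    (k : M → ℝ) (ρ : ℝ) : Prop :=
  ∀ (x : M) (v w : TangentSpace I x), ricci I g x v w + hessian I g k x v w = ρ * g x v w

end Manifold

/-! ### Warped products with Euclidean base -/

section Warped

variable {n m : ℕ} {F : Type*} [TopologicalSpace F] [ChartedSpace (EuclideanSpace ℝ (Fin m)) F]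

/-- The warped product metric `g₀ + f² g_F` on `ℝⁿ × F`, where `g₀` is the Euclidean metric. -/
def warpedMetric (f : EuclideanSpace ℝ (Fin n) → ℝ)
    (gF : ∀ q : F, TangentSpace (𝓡 m) q →L[ℝ] TangentSpace (𝓡 m) q →L[ℝ] ℝ)
    (x : EuclideanSpace ℝ (Fin n) × F) :
    TangentSpace ((𝓡 n).prod (𝓡 m)) x →L[ℝ] TangentSpace ((𝓡 n).prod (𝓡 m)) x →L[ℝ] ℝ :=
  let P : TangentSpace ((𝓡 n).prod (𝓡 m)) x →L[ℝ] EuclideanSpace ℝ (Fin n) :=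
    mfderiv ((𝓡 n).prod (𝓡 m)) (𝓡 n) Prod.fst x
  let Q : TangentSpace ((𝓡 n).prod (𝓡 m)) x →L[ℝ] TangentSpace (𝓡 m) x.2 :=
    mfderiv ((𝓡 n).prod (𝓡 m)) (𝓡 m) Prod.snd x
  ContinuousLinearMap.precomp ℝ P ∘L (innerSL ℝ ∘L P)
    + (f x.1) ^ 2 • (ContinuousLinearMap.precomp ℝ Q ∘L (gF x.2 ∘L Q))

end Warped

end WarpedSoliton

end

/-! In a product chart the metric is a warped product of vector spaces, whose Christoffel symbols
are explicit (`christoffel_localWarped`). Differentiating them and tracing gives `Ric = -(m/f) Hess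
f` on base vectors and `Ric = Ric_F - (f Δf + (m-1)|∇f|²) g_F` on fibre vectors, while the lifted
potential has Hessian `Hess h` on the base and `f ⟨∇f, ∇h⟩ g_F` on the fibre. The Einstein condition
then reduces the soliton equation to `Hess h = ρ g₀ + (m/f) Hess f` and one scalar equation
(`exists_warped_soliton_equations`); the mixed components are not needed.

If `f = φ(x₁)`, then `Hess f = φ'' dx₁²`, so `Hess h - ρ g₀` is a multiple of `dx₁²`. Integrating
along lines orthogonal to the first axis shows that `h` is its restriction to that axis plus a
quadratic polynomial in the other coordinates (`eq_add_sum_of_fderiv_fderiv`). The two equations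
read along the axis are the stated system. -/

namespace WarpedSoliton

open ContinuousLinearMap

/-! ### Christoffel symbols and traces in a vector space. -/

section Local

variable {E : Type*} [NormedAddCommGroup E] [NormedSpace ℝ E]

theorem fderiv_apply_apply {V W X Z : Type*} [NormedAddCommGroup V] [NormedSpace ℝ V]
    [NormedAddCommGroup W] [NormedSpace ℝ W] [NormedAddCommGroup X] [NormedSpace ℝ X]
    [NormedAddCommGroup Z] [NormedSpace ℝ Z] {A : V → W →L[ℝ] X →L[ℝ] Z} {y : V}
    (hA : DifferentiableAt ℝ A y) (u : V) (v : W) (w : X) :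
    fderiv ℝ A y u v w = fderiv ℝ (fun z => A z v w) y u := by
  have h := (hA.hasFDerivAt.clm_apply (hasFDerivAt_const v y)).clm_apply (hasFDerivAt_const w y)
  rw [h.fderiv]
  simp

theorem christoffelLower_apply (G : E → E →L[ℝ] E →L[ℝ] ℝ) (y u v w : E) :
    christoffelLower G y u v w =
      1 / 2 * (fderiv ℝ G y u v w + fderiv ℝ G y v u w - fderiv ℝ G y w u v) := by
  simp [christoffelLower]

theorem metric_christoffel {G : E → E →L[ℝ] E →L[ℝ] ℝ} {y : E} (hG : (G y).IsInvertible)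
    (u v w : E) : G y (christoffel G y u v) w = christoffelLower G y u v w := by
  simp [christoffel, hG.self_apply_inverse]

/-- Nondegeneracy makes the Koszul identity characterise `Γ`, so a proposed formula can be verified
by pairing with every `w`. -/
theorem christoffel_eq_of_metric {G : E → E →L[ℝ] E →L[ℝ] ℝ} {y : E} (hG : (G y).IsInvertible)
    {u v X : E} (h : ∀ w, G y X w = christoffelLower G y u v w) : christoffel G y u v = X := by
  apply hG.injective
  ext w
  rw [metric_christoffel hG, h]

theorem isInvertible_of_pos [FiniteDimensional ℝ E] {B : E →L[ℝ] E →L[ℝ] ℝ}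
    (hB : ∀ v, v ≠ 0 → 0 < B v v) : B.IsInvertible := by
  have hinj : Function.Injective (B : E →ₗ[ℝ] E →L[ℝ] ℝ) := by
    rw [← LinearMap.ker_eq_bot, LinearMap.ker_eq_bot']
    intro v hv
    by_contra hne
    have := hB v hne
    have h0 : B v = 0 := hv
    simp [h0] at this
  have hdim : Module.finrank ℝ E = Module.finrank ℝ (E →L[ℝ] ℝ) := by
    rw [← (LinearMap.toContinuousLinearMap (𝕜 := ℝ) (E := E) (F' := ℝ)).finrank_eq]
    exact (Subspace.dual_finrank_eq (K := ℝ) (V := E)).symm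
  refine ⟨(LinearEquiv.ofInjectiveOfFinrankEq _ hinj hdim).toContinuousLinearEquiv, ?_⟩
  ext v w
  rfl

/-- Inversion is smooth near an invertible operator. This supplies the differentiability that
`fderiv_apply_apply` needs. -/
theorem contDiffAt_christoffel [CompleteSpace E] {G : E → E →L[ℝ] E →L[ℝ] ℝ} {y : E}
    (hG : ContDiffAt ℝ ∞ G y) (hinv : (G y).IsInvertible) : ContDiffAt ℝ ∞ (christoffel G) y := by
  have h1 : ContDiffAt ℝ ∞ (fderiv ℝ G) y := hG.fderiv_right (m := ∞) (by simp)
  have hflip : ContDiffAt ℝ ∞ (fun z => (fderiv ℝ G z).flip) y :=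
    (ContinuousLinearMap.flipₗᵢ ℝ E E (E →L[ℝ] ℝ)).toContinuousLinearEquiv.contDiff.contDiffAt.comp
      y h1
  have h2 : ContDiffAt ℝ ∞ (christoffelLower G) y := by
    unfold christoffelLower
    exact ((h1.add hflip).sub (contDiffAt_const.clm_comp hflip)).const_smul _
  have h3 : ContDiffAt ℝ ∞ (fun z => (G z).inverse) y :=
    hinv.contDiffAt_map_inverse.comp y hG
  unfold christoffel
  exact ((ContinuousLinearMap.contDiff _).contDiffAt.comp y h3).clm_comp h2

theorem curvatureEndo_apply (G : E → E →L[ℝ] E →L[ℝ] ℝ) (y u v w : E) :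
    curvatureEndo G y v w u = fderiv ℝ (christoffel G) y u v w - fderiv ℝ (christoffel G) y v u w
      + christoffel G y u (christoffel G y v w) - christoffel G y v (christoffel G y u w) := by
  simp [curvatureEndo]

theorem _root_.LinearMap.trace_eq_add_of_prod {V W : Type*} [AddCommGroup V] [Module ℝ V]
    [AddCommGroup W] [Module ℝ W] [FiniteDimensional ℝ V] [FiniteDimensional ℝ W]
    (T : V × W →ₗ[ℝ] V × W) :
    LinearMap.trace ℝ (V × W) T =
      LinearMap.trace ℝ V (LinearMap.fst ℝ V W ∘ₗ T ∘ₗ LinearMap.inl ℝ V W) +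
      LinearMap.trace ℝ W (LinearMap.snd ℝ V W ∘ₗ T ∘ₗ LinearMap.inr ℝ V W) := by
  have h : T = LinearMap.inl ℝ V W ∘ₗ (LinearMap.fst ℝ V W ∘ₗ T) +
      LinearMap.inr ℝ V W ∘ₗ (LinearMap.snd ℝ V W ∘ₗ T) := by
    apply LinearMap.ext
    intro p
    simp
  conv_lhs => rw [h]
  rw [map_add, LinearMap.trace_comp_comm' _ (LinearMap.inl ℝ V W),
    LinearMap.trace_comp_comm' _ (LinearMap.inr ℝ V W)]
  rfl

end Local

/-! ### First derivatives and Christoffel symbols of a warped product. -/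

section WarpedLocal

variable {E₁ : Type*} [NormedAddCommGroup E₁] [InnerProductSpace ℝ E₁]
  {E₂ : Type*} [NormedAddCommGroup E₂] [NormedSpace ℝ E₂]

/-- The warped product metric `g₀ + f² g` on a product of vector spaces. -/
noncomputable def localWarped (f : E₁ → ℝ) (g : E₂ → E₂ →L[ℝ] E₂ →L[ℝ] ℝ) (y : E₁ × E₂) :
    E₁ × E₂ →L[ℝ] E₁ × E₂ →L[ℝ] ℝ :=
  ContinuousLinearMap.precomp ℝ (fst ℝ E₁ E₂) ∘L (innerSL ℝ ∘L fst ℝ E₁ E₂)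
    + (f y.1) ^ 2 • (ContinuousLinearMap.precomp ℝ (snd ℝ E₁ E₂) ∘L (g y.2 ∘L snd ℝ E₁ E₂))

theorem localWarped_apply (f : E₁ → ℝ) (g : E₂ → E₂ →L[ℝ] E₂ →L[ℝ] ℝ) (y u v : E₁ × E₂) :
    localWarped f g y u v = inner ℝ u.1 v.1 + f y.1 ^ 2 * g y.2 u.2 v.2 := by
  simp [localWarped]
  rfl

theorem contDiffAt_localWarped {f : E₁ → ℝ} {g : E₂ → E₂ →L[ℝ] E₂ →L[ℝ] ℝ} {y : E₁ × E₂}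
    (hf : ContDiffAt ℝ ∞ f y.1) (hg : ContDiffAt ℝ ∞ g y.2) :
    ContDiffAt ℝ ∞ (localWarped f g) y := by
  unfold localWarped
  refine contDiffAt_const.add (ContDiffAt.fun_smul ?_ ?_)
  · exact (hf.comp y contDiffAt_fst).pow 2
  · exact contDiffAt_const.clm_comp ((hg.comp y contDiffAt_snd).clm_comp contDiffAt_const)

theorem localWarped_pos {f : E₁ → ℝ} {g : E₂ → E₂ →L[ℝ] E₂ →L[ℝ] ℝ} {y : E₁ × E₂}
    (hf : 0 < f y.1) (hg : ∀ v, v ≠ 0 → 0 < g y.2 v v) (v : E₁ × E₂) (hv : v ≠ 0) :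
    0 < localWarped f g y v v := by
  rw [localWarped_apply]
  have hnn : 0 ≤ g y.2 v.2 v.2 := by
    rcases eq_or_ne v.2 0 with h | h
    · simp [h]
    · exact (hg _ h).le
  rcases eq_or_ne v.2 0 with h | h
  · have h1 : v.1 ≠ 0 := fun h1 => hv (Prod.ext h1 h)
    have := real_inner_self_pos.2 h1
    positivity
  · have := hg _ h
    have := real_inner_self_nonneg (x := v.1)
    positivity

theorem fderiv_localWarped {f : E₁ → ℝ} {g : E₂ → E₂ →L[ℝ] E₂ →L[ℝ] ℝ} {y : E₁ × E₂}
    (hf : ContDiffAt ℝ ∞ f y.1) (hg : ContDiffAt ℝ ∞ g y.2) (u v w : E₁ × E₂) :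
    fderiv ℝ (localWarped f g) y u v w =
      2 * f y.1 * fderiv ℝ f y.1 u.1 * g y.2 v.2 w.2 +
        f y.1 ^ 2 * fderiv ℝ g y.2 u.2 v.2 w.2 := by
  have hne : (∞ : WithTop ℕ∞) ≠ 0 := by simp
  rw [fderiv_apply_apply ((contDiffAt_localWarped hf hg).differentiableAt hne)]
  simp only [localWarped_apply]
  have h1 : HasFDerivAt (fun z : E₁ × E₂ => f z.1) _ y :=
    (hf.differentiableAt hne).hasFDerivAt.comp y hasFDerivAt_fst
  have h2 : HasFDerivAt (fun z : E₁ × E₂ => g z.2) _ y :=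
    (hg.differentiableAt hne).hasFDerivAt.comp y hasFDerivAt_snd
  have h3 := (h2.clm_apply (hasFDerivAt_const v.2 y)).clm_apply (hasFDerivAt_const w.2 y)
  have h4 : HasFDerivAt (fun z : E₁ × E₂ => inner ℝ v.1 w.1 + f z.1 ^ 2 * g z.2 v.2 w.2) _ y :=
    ((h1.pow 2).mul h3).const_add (inner ℝ v.1 w.1)
  rw [h4.fderiv]
  simp
  ring

variable {f : E₁ → ℝ} {N : E₁ → E₁} {g : E₂ → E₂ →L[ℝ] E₂ →L[ℝ] ℝ}

/-- Here `N` is the gradient of `f`; its base term comes from differentiating the factor `f²` in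
base directions. -/
theorem christoffel_localWarped [FiniteDimensional ℝ E₁] [FiniteDimensional ℝ E₂]
    (hN : ∀ a u, fderiv ℝ f a u = inner ℝ (N a) u) {y : E₁ × E₂}
    (hf : ContDiffAt ℝ ∞ f y.1) (hg : ContDiffAt ℝ ∞ g y.2) (hpos : 0 < f y.1)
    (hgpos : ∀ v, v ≠ 0 → 0 < g y.2 v v) (u v : E₁ × E₂) :
    christoffel (localWarped f g) y u v =
      (-(f y.1 * g y.2 u.2 v.2) • N y.1,
        christoffel g y.2 u.2 v.2 + ((f y.1)⁻¹ * fderiv ℝ f y.1 u.1) • v.2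
          + ((f y.1)⁻¹ * fderiv ℝ f y.1 v.1) • u.2) := by
  apply christoffel_eq_of_metric (isInvertible_of_pos (localWarped_pos hpos hgpos))
  intro w
  simp only [christoffelLower_apply, fderiv_localWarped hf hg, localWarped_apply, map_add, map_smul,
    add_apply, smul_apply, smul_eq_mul, inner_smul_left,
    metric_christoffel (isInvertible_of_pos hgpos), ← hN]
  simp
  field_simp
  ring

end WarpedLocal

/-! ### Ricci tensor and Hessian of a warped product. -/

section WarpedCurvature

variable {E₁ : Type*} [NormedAddCommGroup E₁] [InnerProductSpace ℝ E₁] [FiniteDimensional ℝ E₁]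
  {E₂ : Type*} [NormedAddCommGroup E₂] [NormedSpace ℝ E₂] [FiniteDimensional ℝ E₂]
  {f : E₁ → ℝ} {N : E₁ → E₁} {g : E₂ → E₂ →L[ℝ] E₂ →L[ℝ] ℝ} {U : Set E₂} {y : E₁ × E₂}

theorem fderiv_christoffel_localWarped
    (hf : ContDiff ℝ ∞ f) (hpos : ∀ a, 0 < f a) (hN : ∀ a u, fderiv ℝ f a u = inner ℝ (N a) u)
    (hNd : Differentiable ℝ N) (hU : IsOpen U) (hg : ContDiffOn ℝ ∞ g U)
    (hgpos : ∀ b ∈ U, ∀ v, v ≠ 0 → 0 < g b v v) (hy : y.2 ∈ U) (u v w : E₁ × E₂) :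
    fderiv ℝ (christoffel (localWarped f g)) y u v w =
      (-(fderiv ℝ f y.1 u.1 * g y.2 v.2 w.2 + f y.1 * fderiv ℝ g y.2 u.2 v.2 w.2) • N y.1
          - (f y.1 * g y.2 v.2 w.2) • fderiv ℝ N y.1 u.1,
        fderiv ℝ (christoffel g) y.2 u.2 v.2 w.2
          + (-(f y.1 ^ 2)⁻¹ * fderiv ℝ f y.1 u.1 * fderiv ℝ f y.1 v.1
              + (f y.1)⁻¹ * fderiv ℝ (fderiv ℝ f) y.1 u.1 v.1) • w.2
          + (-(f y.1 ^ 2)⁻¹ * fderiv ℝ f y.1 u.1 * fderiv ℝ f y.1 w.1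
              + (f y.1)⁻¹ * fderiv ℝ (fderiv ℝ f) y.1 u.1 w.1) • v.2) := by
  have hne : (∞ : WithTop ℕ∞) ≠ 0 := by simp
  have hgy : ContDiffAt ℝ ∞ g y.2 := hg.contDiffAt (hU.mem_nhds hy)
  have hΓ : DifferentiableAt ℝ (christoffel (localWarped f g)) y :=
    (contDiffAt_christoffel (contDiffAt_localWarped hf.contDiffAt hgy)
      (isInvertible_of_pos (localWarped_pos (hpos _) (hgpos _ hy)))).differentiableAt hne
  -- The closed formula holds on a whole neighbourhood of `y`, so it may be differentiated.
  have hev : (fun z => christoffel (localWarped f g) z v w) =ᶠ[nhds y] fun z =>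
      (-(f z.1 * g z.2 v.2 w.2) • N z.1,
        christoffel g z.2 v.2 w.2 + ((f z.1)⁻¹ * fderiv ℝ f z.1 v.1) • w.2
          + ((f z.1)⁻¹ * fderiv ℝ f z.1 w.1) • v.2) := by
    filter_upwards [(hU.preimage continuous_snd).mem_nhds hy] with z hz
    exact christoffel_localWarped hN hf.contDiffAt (hg.contDiffAt (hU.mem_nhds hz)) (hpos _)
      (hgpos _ hz) v w
  rw [fderiv_apply_apply hΓ, hev.fderiv_eq]
  have hf1 : HasFDerivAt (fun z : E₁ × E₂ => f z.1) _ y :=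
    (hf.differentiable hne _).hasFDerivAt.comp y hasFDerivAt_fst
  have hinv : HasFDerivAt (fun z : E₁ × E₂ => (f z.1)⁻¹) _ y :=
    (hasDerivAt_inv (hpos y.1).ne').comp_hasFDerivAt y hf1
  have hdf : HasFDerivAt (fun z : E₁ × E₂ => fderiv ℝ f z.1) _ y :=
    ((hf.fderiv_right (m := ∞) (by simp)).differentiable hne _).hasFDerivAt.comp y hasFDerivAt_fst
  have hN1 : HasFDerivAt (fun z : E₁ × E₂ => N z.1) _ y :=
    (hNd _).hasFDerivAt.comp y hasFDerivAt_fst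
  have hg2 : HasFDerivAt (fun z : E₁ × E₂ => g z.2) _ y :=
    (hgy.differentiableAt hne).hasFDerivAt.comp y hasFDerivAt_snd
  have hΓ2 : HasFDerivAt (fun z : E₁ × E₂ => christoffel g z.2) _ y :=
    ((contDiffAt_christoffel hgy (isInvertible_of_pos (hgpos _ hy))).differentiableAt
      hne).hasFDerivAt.comp y hasFDerivAt_snd
  have hg3 := (hg2.clm_apply (hasFDerivAt_const v.2 y)).clm_apply (hasFDerivAt_const w.2 y)
  have hΓ3 := (hΓ2.clm_apply (hasFDerivAt_const v.2 y)).clm_apply (hasFDerivAt_const w.2 y)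
  have hv := (hinv.mul (hdf.clm_apply (hasFDerivAt_const v.1 y))).smul (hasFDerivAt_const w.2 y)
  have hw := (hinv.mul (hdf.clm_apply (hasFDerivAt_const w.1 y))).smul (hasFDerivAt_const v.2 y)
  have h : HasFDerivAt (fun z : E₁ × E₂ =>
      (-(f z.1 * g z.2 v.2 w.2) • N z.1,
        christoffel g z.2 v.2 w.2 + ((f z.1)⁻¹ * fderiv ℝ f z.1 v.1) • w.2
          + ((f z.1)⁻¹ * fderiv ℝ f z.1 w.1) • v.2)) _ y :=
    ((hf1.mul hg3).neg.smul hN1).prodMk ((hΓ3.add hv).add hw)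
  rw [h.fderiv]
  ext
  · simp
    module
  · simp
    module

/-- The flat base contributes nothing to the trace; on the fibre the curvature endomorphism is the
scalar `-f⁻¹ Hess f(v, w)`, counted once per fibre dimension. -/
theorem localRicci_localWarped_base
    (hf : ContDiff ℝ ∞ f) (hpos : ∀ a, 0 < f a) (hN : ∀ a u, fderiv ℝ f a u = inner ℝ (N a) u)
    (hNd : Differentiable ℝ N) (hU : IsOpen U) (hg : ContDiffOn ℝ ∞ g U)
    (hgpos : ∀ b ∈ U, ∀ v, v ≠ 0 → 0 < g b v v) (hy : y.2 ∈ U) (v w : E₁) :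
    localRicci (localWarped f g) y (v, 0) (w, 0) =
      -(Module.finrank ℝ E₂ / f y.1 * fderiv ℝ (fderiv ℝ f) y.1 v w) := by
  have hΓ := christoffel_localWarped hN hf.contDiffAt (hg.contDiffAt (hU.mem_nhds hy)) (hpos _)
    (hgpos _ hy)
  have hDΓ := fderiv_christoffel_localWarped hf hpos hN hNd hU hg hgpos hy
  have hp := (hpos y.1).ne'
  unfold localRicci
  rw [LinearMap.trace_eq_add_of_prod]
  have h1 : LinearMap.fst ℝ E₁ E₂ ∘ₗ
      (curvatureEndo (localWarped f g) y (v, 0) (w, 0) : E₁ × E₂ →ₗ[ℝ] E₁ × E₂) ∘ₗ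
        LinearMap.inl ℝ E₁ E₂ = 0 := by
    apply LinearMap.ext
    intro u
    simp [curvatureEndo_apply, hΓ, hDΓ]
  have h2 : LinearMap.snd ℝ E₁ E₂ ∘ₗ
      (curvatureEndo (localWarped f g) y (v, 0) (w, 0) : E₁ × E₂ →ₗ[ℝ] E₁ × E₂) ∘ₗ
        LinearMap.inr ℝ E₁ E₂ = -((f y.1)⁻¹ * fderiv ℝ (fderiv ℝ f) y.1 v w) • LinearMap.id := by
    apply LinearMap.ext
    intro u
    simp [curvatureEndo_apply, hΓ, hDΓ]
    match_scalars
    field_simp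
    ring
  rw [h1, h2]
  simp
  ring

/-- The base block is `-f g(v, w) dN`, which gives the Laplacian. The fibre block is the curvature
of `g` corrected by `-|∇f|² (g(v, w) id - g(·, w) v)`, and the rank-one term lowers the dimension
factor to `dim E₂ - 1`. -/
theorem localRicci_localWarped_fiber
    (hf : ContDiff ℝ ∞ f) (hpos : ∀ a, 0 < f a) (hN : ∀ a u, fderiv ℝ f a u = inner ℝ (N a) u)
    (hNd : Differentiable ℝ N) (hU : IsOpen U) (hg : ContDiffOn ℝ ∞ g U)
    (hgpos : ∀ b ∈ U, ∀ v, v ≠ 0 → 0 < g b v v) (hy : y.2 ∈ U) (v w : E₂) :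
    localRicci (localWarped f g) y (0, v) (0, w) =
      localRicci g y.2 v w - (f y.1 * LinearMap.trace ℝ E₁ (fderiv ℝ N y.1)
        + (Module.finrank ℝ E₂ - 1) * fderiv ℝ f y.1 (N y.1)) * g y.2 v w := by
  have hΓ := christoffel_localWarped hN hf.contDiffAt (hg.contDiffAt (hU.mem_nhds hy)) (hpos _)
    (hgpos _ hy)
  have hDΓ := fderiv_christoffel_localWarped hf hpos hN hNd hU hg hgpos hy
  have hp := (hpos y.1).ne'
  unfold localRicci
  rw [LinearMap.trace_eq_add_of_prod]
  have h1 : LinearMap.fst ℝ E₁ E₂ ∘ₗ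
      (curvatureEndo (localWarped f g) y (0, v) (0, w) : E₁ × E₂ →ₗ[ℝ] E₁ × E₂) ∘ₗ
        LinearMap.inl ℝ E₁ E₂ = -(f y.1 * g y.2 v w) • (fderiv ℝ N y.1 : E₁ →ₗ[ℝ] E₁) := by
    apply LinearMap.ext
    intro u
    simp [curvatureEndo_apply, hΓ, hDΓ]
    match_scalars
    · field_simp
      ring
    · ring
  have h2 : LinearMap.snd ℝ E₁ E₂ ∘ₗ
      (curvatureEndo (localWarped f g) y (0, v) (0, w) : E₁ × E₂ →ₗ[ℝ] E₁ × E₂) ∘ₗ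
        LinearMap.inr ℝ E₁ E₂ = (curvatureEndo g y.2 v w : E₂ →ₗ[ℝ] E₂)
          - (fderiv ℝ f y.1 (N y.1) * g y.2 v w) • LinearMap.id
          + fderiv ℝ f y.1 (N y.1) • ((g y.2).flip w : E₂ →ₗ[ℝ] ℝ).smulRight v := by
    apply LinearMap.ext
    intro u
    simp [curvatureEndo_apply, hΓ, hDΓ]
    match_scalars
    all_goals field_simp
  rw [h1, h2]
  simp [LinearMap.trace_smulRight]
  ring

/-- As `k` ignores the fibre, only the base component `-f g(v, w) N` of `Γ` enters. -/
theorem localHessian_localWarped {k : E₁ → ℝ} (hk : ContDiff ℝ ∞ k)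
    (hf : ContDiff ℝ ∞ f) (hpos : ∀ a, 0 < f a) (hN : ∀ a u, fderiv ℝ f a u = inner ℝ (N a) u)
    (hU : IsOpen U) (hg : ContDiffOn ℝ ∞ g U)
    (hgpos : ∀ b ∈ U, ∀ v, v ≠ 0 → 0 < g b v v) (hy : y.2 ∈ U) (v w : E₁ × E₂) :
    localHessian (localWarped f g) (fun z => k z.1) y v w =
      fderiv ℝ (fderiv ℝ k) y.1 v.1 w.1
        + f y.1 * g y.2 v.2 w.2 * fderiv ℝ k y.1 (N y.1) := by
  have hne : (∞ : WithTop ℕ∞) ≠ 0 := by simp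
  have h1 : fderiv ℝ (fun z : E₁ × E₂ => k z.1) = fun z => fderiv ℝ k z.1 ∘L fst ℝ E₁ E₂ := by
    ext1 z
    exact ((hk.differentiable hne _).hasFDerivAt.comp z hasFDerivAt_fst).fderiv
  have h2 : HasFDerivAt (fun z : E₁ × E₂ => fderiv ℝ k z.1 ∘L fst ℝ E₁ E₂) _ y :=
    (((hk.fderiv_right (m := ∞) (by simp)).differentiable hne _).hasFDerivAt.comp y
      hasFDerivAt_fst).clm_comp (hasFDerivAt_const _ _)
  unfold localHessian
  rw [h1, h2.fderiv, christoffel_localWarped hN hf.contDiffAt (hg.contDiffAt (hU.mem_nhds hy))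
    (hpos _) (hgpos _ hy)]
  simp

end WarpedCurvature

/-! ### Dependence on the germ of the metric only. -/

section Congruence

variable {E : Type*} [NormedAddCommGroup E] [NormedSpace ℝ E]
  {G G' : E → E →L[ℝ] E →L[ℝ] ℝ} {y : E}

theorem christoffel_eventuallyEq (h : G =ᶠ[nhds y] G') :
    christoffel G =ᶠ[nhds y] christoffel G' := by
  filter_upwards [h, h.fderiv (𝕜 := ℝ)] with z hz hz'
  simp only [christoffel, christoffelLower, hz, hz']

theorem localRicci_congr (h : G =ᶠ[nhds y] G') (v w : E) :
    localRicci G y v w = localRicci G' y v w := by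
  have hΓ := christoffel_eventuallyEq h
  simp only [localRicci, curvatureEndo, hΓ.fderiv_eq, hΓ.eq_of_nhds]

theorem localHessian_congr (h : G =ᶠ[nhds y] G') (k : E → ℝ) (v w : E) :
    localHessian G k y v w = localHessian G' k y v w := by
  simp only [localHessian, (christoffel_eventuallyEq h).eq_of_nhds]

end Congruence

/-! ### Metrics and tensor equations read in a chart. -/

section Charts

variable {E : Type*} [NormedAddCommGroup E] [NormedSpace ℝ E]
  {H : Type*} [TopologicalSpace H] {I : ModelWithCorners ℝ E H}
  {M : Type*} [TopologicalSpace M] [ChartedSpace H M]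

theorem metricInChart_apply (g : ∀ x : M, TangentSpace I x →L[ℝ] TangentSpace I x →L[ℝ] ℝ)
    (x : M) (y u v : E) :
    metricInChart I g x y u v = g ((extChartAt I x).symm y)
      (mfderiv 𝓘(ℝ, E) I (extChartAt I x).symm y u)
      (mfderiv 𝓘(ℝ, E) I (extChartAt I x).symm y v) := rfl

theorem metricInChart_extChartAt_apply
    (g : ∀ x : M, TangentSpace I x →L[ℝ] TangentSpace I x →L[ℝ] ℝ) (x : M) (u v : E) :
    metricInChart I g x (extChartAt I x x) u v =
      g x (mfderiv 𝓘(ℝ, E) I (extChartAt I x).symm (extChartAt I x x) u)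
        (mfderiv 𝓘(ℝ, E) I (extChartAt I x).symm (extChartAt I x x) v) := by
  -- The two base points are equal but not definitionally so; generalising `z` avoids rewriting
  -- inside dependent types.
  have h : ∀ z, z = x → ∀ u v : E, g z u v = g x u v := by rintro z rfl u v; rfl
  exact h _ (extChartAt_to_inv x) _ _

variable [I.Boundaryless]

theorem metricInChart_pos [IsManifold I 1 M]
    {g : ∀ x : M, TangentSpace I x →L[ℝ] TangentSpace I x →L[ℝ] ℝ}
    (hg : ∀ x v, v ≠ 0 → 0 < g x v v) (x : M) {y : E} (hy : y ∈ (extChartAt I x).target)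
    (v : E) (hv : v ≠ 0) : 0 < metricInChart I g x y v v := by
  rw [metricInChart_apply]
  apply hg
  have h := (isInvertible_mfderivWithin_extChartAt_symm hy).injective
  rw [I.range_eq_univ, mfderivWithin_univ] at h
  intro h0
  exact hv (h (h0.trans (map_zero _).symm))

theorem contDiffOn_metricInChart [FiniteDimensional ℝ E] [IsManifold I ∞ M]
    {g : ∀ x : M, TangentSpace I x →L[ℝ] TangentSpace I x →L[ℝ] ℝ}
    (hg : ContMDiff I (I.prod 𝓘(ℝ, E →L[ℝ] E →L[ℝ] ℝ)) ∞
      (fun b ↦ Bundle.TotalSpace.mk' (E →L[ℝ] E →L[ℝ] ℝ)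
        (E := fun b : M => TangentSpace I b →L[ℝ] TangentSpace I b →L[ℝ] ℝ) b (g b))) (x : M) :
    ContDiffOn ℝ ∞ (metricInChart I g x) (extChartAt I x).target := by
  have : IsManifold I 1 M := IsManifold.of_le (n := ∞) (by simp)
  rw [contDiffOn_clm_apply]
  intro u
  rw [contDiffOn_clm_apply]
  intro v
  have hopen : IsOpen (extChartAt I x).target := isOpen_extChartAt_target x
  have hψ := contMDiffOn_extChartAt_symm (I := I) (n := ∞) x
  -- Constant vectors pushed forward by the inverse chart are smooth fields along it; the smooth
  -- metric is then evaluated on two of them.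
  have hV : ∀ v : E, ContMDiffOn 𝓘(ℝ, E) (I.prod 𝓘(ℝ, E)) ∞
      (fun y : E => Bundle.TotalSpace.mk' E (E := (TangentSpace I : M → Type _))
        ((extChartAt I x).symm y) (mfderiv 𝓘(ℝ, E) I (extChartAt I x).symm y v))
      (extChartAt I x).target := by
    intro v
    have h1 := hψ.contMDiffOn_tangentMapWithin (m := ∞) (by simp) hopen.uniqueMDiffOn
    have h2 : ContMDiff 𝓘(ℝ, E) 𝓘(ℝ, E).tangent ∞
        (fun y : E => (⟨y, v⟩ : TangentBundle 𝓘(ℝ, E) E)) :=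
      contMDiff_vectorSpace_iff_contDiff.2 contDiff_const
    refine (h1.comp h2.contMDiffOn (fun y hy => hy)).congr fun y hy => ?_
    simp only [tangentMapWithin, Function.comp_apply, mfderivWithin_of_isOpen hopen hy]
  have h := ContMDiffOn.clm_bundle_apply₂ (F₁ := E) (F₂ := E) (F₃ := ℝ)
    (E₃ := Bundle.Trivial M ℝ) (hg.comp_contMDiffOn hψ) (hV u) (hV v)
  rw [← contMDiffOn_iff_contDiffOn]
  intro y hy
  exact (Bundle.contMDiffWithinAt_totalSpace.1 (h y hy)).2

variable [IsManifold I 1 M]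

theorem mfderiv_extChartAt_mfderiv_symm (x : M) (u : E) :
    mfderiv I 𝓘(ℝ, E) (extChartAt I x) x
      (mfderiv 𝓘(ℝ, E) I (extChartAt I x).symm (extChartAt I x x) u) = u := by
  have h := mfderiv_extChartAt_comp_mfderivWithin_extChartAt_symm' (I := I)
    (mem_extChartAt_source (I := I) x)
  rw [I.range_eq_univ, mfderivWithin_univ] at h
  exact congr($h u)

theorem IsEinstein.localRicci_metricInChart
    {g : ∀ x : M, TangentSpace I x →L[ℝ] TangentSpace I x →L[ℝ] ℝ} {c : ℝ}
    (hg : IsEinstein I g c) (x : M) (u v : E) :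
    localRicci (metricInChart I g x) (extChartAt I x x) u v =
      c * metricInChart I g x (extChartAt I x x) u v := by
  have h := hg x (mfderiv 𝓘(ℝ, E) I (extChartAt I x).symm (extChartAt I x x) u)
    (mfderiv 𝓘(ℝ, E) I (extChartAt I x).symm (extChartAt I x x) v)
  rw [metricInChart_extChartAt_apply]
  unfold ricci at h
  rwa [mfderiv_extChartAt_mfderiv_symm, mfderiv_extChartAt_mfderiv_symm] at h

theorem IsGradientRicciSoliton.localRicci_add_localHessian
    {g : ∀ x : M, TangentSpace I x →L[ℝ] TangentSpace I x →L[ℝ] ℝ} {k : M → ℝ} {ρ : ℝ}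
    (hg : IsGradientRicciSoliton I g k ρ) (x : M) (u v : E) :
    localRicci (metricInChart I g x) (extChartAt I x x) u v +
        localHessian (metricInChart I g x) (k ∘ (extChartAt I x).symm) (extChartAt I x x) u v =
      ρ * metricInChart I g x (extChartAt I x x) u v := by
  have h := hg x (mfderiv 𝓘(ℝ, E) I (extChartAt I x).symm (extChartAt I x x) u)
    (mfderiv 𝓘(ℝ, E) I (extChartAt I x).symm (extChartAt I x x) v)
  rw [metricInChart_extChartAt_apply]
  unfold ricci hessian at h
  rwa [mfderiv_extChartAt_mfderiv_symm, mfderiv_extChartAt_mfderiv_symm] at h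

end Charts

/-! ### The warped product in a product chart, and the reduced equations. -/

section Product

variable {n m : ℕ} {F : Type*} [TopologicalSpace F] [ChartedSpace (EuclideanSpace ℝ (Fin m)) F]

theorem extChartAt_prod_euclidean (x : EuclideanSpace ℝ (Fin n) × F) :
    extChartAt ((𝓡 n).prod (𝓡 m)) x =
      (PartialEquiv.refl (EuclideanSpace ℝ (Fin n))).prod (extChartAt (𝓡 m) x.2) := by
  rw [extChartAt_prod, extChartAt_model_space_eq_id]

theorem warpedMetric_apply (f : EuclideanSpace ℝ (Fin n) → ℝ)
    (gF : ∀ q : F, TangentSpace (𝓡 m) q →L[ℝ] TangentSpace (𝓡 m) q →L[ℝ] ℝ)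
    (x : EuclideanSpace ℝ (Fin n) × F) (u v : TangentSpace ((𝓡 n).prod (𝓡 m)) x) :
    warpedMetric f gF x u v = inner ℝ (E := EuclideanSpace ℝ (Fin n)) u.1 v.1 +
      f x.1 ^ 2 * gF x.2 u.2 v.2 := by
  simp only [warpedMetric, mfderiv_fst, mfderiv_snd]
  rfl

theorem metricInChart_warpedMetric [IsManifold (𝓡 m) ∞ F] (f : EuclideanSpace ℝ (Fin n) → ℝ)
    (gF : ∀ q : F, TangentSpace (𝓡 m) q →L[ℝ] TangentSpace (𝓡 m) q →L[ℝ] ℝ)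
    (x : EuclideanSpace ℝ (Fin n) × F) {y : EuclideanSpace ℝ (Fin n) × EuclideanSpace ℝ (Fin m)}
    (hy : y.2 ∈ (extChartAt (𝓡 m) x.2).target) :
    metricInChart ((𝓡 n).prod (𝓡 m)) (warpedMetric f gF) x y =
      localWarped f (metricInChart (𝓡 m) gF x.2) y := by
  have : IsManifold (𝓡 m) 1 F := IsManifold.of_le (n := ∞) (by simp)
  have hd : MDifferentiableAt 𝓘(ℝ, EuclideanSpace ℝ (Fin m)) (𝓡 m)
      (extChartAt (𝓡 m) x.2).symm y.2 := by
    have := mdifferentiableWithinAt_extChartAt_symm (I := 𝓡 m) hy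
    rwa [(𝓡 m).range_eq_univ, mdifferentiableWithinAt_univ] at this
  have hD : mfderiv 𝓘(ℝ, EuclideanSpace ℝ (Fin n) × EuclideanSpace ℝ (Fin m))
      ((𝓡 n).prod (𝓡 m)) (Prod.map id (extChartAt (𝓡 m) x.2).symm) y =
      (ContinuousLinearMap.id ℝ (EuclideanSpace ℝ (Fin n))).prodMap
        (mfderiv 𝓘(ℝ, EuclideanSpace ℝ (Fin m)) (𝓡 m) (extChartAt (𝓡 m) x.2).symm y.2) := by
    rw [modelWithCornersSelf_prod, ← chartedSpaceSelf_prod]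
    exact (mfderiv_prodMap (I := 𝓡 n) (I' := 𝓡 m) (J := 𝓡 n) (J' := 𝓡 m) (p := y)
      mdifferentiableAt_id hd).trans (by rw [mfderiv_id]; rfl)
  refine ContinuousLinearMap.ext fun u => ContinuousLinearMap.ext fun v => ?_
  rw [metricInChart_apply, localWarped_apply, metricInChart_apply]
  -- Both the base point and the tangent spaces depend on the inverse chart, so it is replaced as a
  -- whole through a variable `ψ`.
  have h : ∀ ψ : EuclideanSpace ℝ (Fin n) × EuclideanSpace ℝ (Fin m) →
      EuclideanSpace ℝ (Fin n) × F, ψ = Prod.map id (extChartAt (𝓡 m) x.2).symm →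
      warpedMetric f gF (ψ y)
        (mfderiv 𝓘(ℝ, EuclideanSpace ℝ (Fin n) × EuclideanSpace ℝ (Fin m))
          ((𝓡 n).prod (𝓡 m)) ψ y u)
        (mfderiv 𝓘(ℝ, EuclideanSpace ℝ (Fin n) × EuclideanSpace ℝ (Fin m))
          ((𝓡 n).prod (𝓡 m)) ψ y v) =
      inner ℝ u.1 v.1 + f y.1 ^ 2 * gF ((extChartAt (𝓡 m) x.2).symm y.2)
        (mfderiv 𝓘(ℝ, EuclideanSpace ℝ (Fin m)) (𝓡 m) (extChartAt (𝓡 m) x.2).symm y.2 u.2)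
        (mfderiv 𝓘(ℝ, EuclideanSpace ℝ (Fin m)) (𝓡 m) (extChartAt (𝓡 m) x.2).symm y.2 v.2) := by
    rintro _ rfl
    rw [warpedMetric_apply, hD]
    rfl
  apply h
  rw [extChartAt_prod_euclidean]
  rfl

theorem exists_warped_soliton_equations [IsManifold (𝓡 m) ∞ F] [Nonempty F] (hm : 1 ≤ m)
    (gF : Bundle.ContMDiffRiemannianMetric (𝓡 m) ∞ (EuclideanSpace ℝ (Fin m))
      (fun q : F => TangentSpace (𝓡 m) q))
    {lam ρ : ℝ} (hF : IsEinstein (𝓡 m) gF.inner lam)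
    {f h : EuclideanSpace ℝ (Fin n) → ℝ} (hf : ContDiff ℝ ∞ f) (hh : ContDiff ℝ ∞ h)
    (hpos : ∀ x, 0 < f x)
    (hsol : IsGradientRicciSoliton ((𝓡 n).prod (𝓡 m)) (warpedMetric f gF.inner)
      (fun x : EuclideanSpace ℝ (Fin n) × F => h x.1) ρ)
    {N : EuclideanSpace ℝ (Fin n) → EuclideanSpace ℝ (Fin n)}
    (hN : ∀ a u, fderiv ℝ f a u = inner ℝ (N a) u) (hNd : Differentiable ℝ N)
    (x : EuclideanSpace ℝ (Fin n)) :
    (∀ v w, fderiv ℝ (fderiv ℝ h) x v w =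
      ρ * inner ℝ v w + m / f x * fderiv ℝ (fderiv ℝ f) x v w) ∧
    lam - f x * LinearMap.trace ℝ _ (fderiv ℝ N x : _ →ₗ[ℝ] EuclideanSpace ℝ (Fin n))
      - (m - 1) * fderiv ℝ f x (N x) + f x * fderiv ℝ h x (N x) = ρ * f x ^ 2 := by
  have : IsManifold (𝓡 m) 1 F := IsManifold.of_le (n := ∞) (by simp)
  obtain ⟨q⟩ := ‹Nonempty F›
  set g := metricInChart (𝓡 m) gF.inner q
  set U := (extChartAt (𝓡 m) q).target
  have hU : IsOpen U := isOpen_extChartAt_target q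
  have hg : ContDiffOn ℝ ∞ g U := contDiffOn_metricInChart gF.contMDiff q
  have hgpos : ∀ b ∈ U, ∀ v, v ≠ 0 → 0 < g b v v := fun b hb v hv =>
    metricInChart_pos gF.pos q hb v hv
  set y : EuclideanSpace ℝ (Fin n) × EuclideanSpace ℝ (Fin m) := (x, extChartAt (𝓡 m) q q)
    with hy_def
  have hy : y.2 ∈ U := mem_extChartAt_target q
  have hev : metricInChart ((𝓡 n).prod (𝓡 m)) (warpedMetric f gF.inner) (x, q) =ᶠ[nhds y]
      localWarped f g := by
    filter_upwards [(hU.preimage continuous_snd).mem_nhds hy] with z hz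
    exact metricInChart_warpedMetric f gF.inner (x, q) hz
  have hs := hsol.localRicci_add_localHessian (x, q)
  have hyx : extChartAt ((𝓡 n).prod (𝓡 m)) (x, q) (x, q) = y := by
    rw [extChartAt_prod_euclidean]
    rfl
  have hk : (fun z : EuclideanSpace ℝ (Fin n) × F => h z.1) ∘
      (extChartAt ((𝓡 n).prod (𝓡 m)) (x, q)).symm = fun z => h z.1 := by
    rw [extChartAt_prod_euclidean]
    rfl
  rw [hk, hyx] at hs
  have hcongr : ∀ v w, localRicci (localWarped f g) y v w +
      localHessian (localWarped f g) (fun z => h z.1) y v w = ρ * localWarped f g y v w := by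
    intro v w
    rw [← localRicci_congr hev, ← localHessian_congr hev, ← hev.eq_of_nhds]
    exact hs v w
  constructor
  · intro v w
    have h1 := hcongr (v, 0) (w, 0)
    rw [localRicci_localWarped_base hf hpos hN hNd hU hg hgpos hy,
      localHessian_localWarped hh hf hpos hN hU hg hgpos hy, localWarped_apply] at h1
    simp [hy_def] at h1
    linarith
  -- Since `m ≥ 1` there is a nonzero fibre vector; the common factor `g(v, v) > 0` then cancels.
  · obtain ⟨v, hv⟩ : ∃ v : EuclideanSpace ℝ (Fin m), v ≠ 0 :=
      ⟨EuclideanSpace.single ⟨0, hm⟩ 1, by simp⟩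
    have hE : localRicci g y.2 v v = lam * g y.2 v v := hF.localRicci_metricInChart q v v
    have h1 := hcongr (0, v) (0, v)
    rw [localRicci_localWarped_fiber hf hpos hN hNd hU hg hgpos hy,
      localHessian_localWarped hh hf hpos hN hU hg hgpos hy, localWarped_apply,
      hE] at h1
    have h2 := hgpos _ hy v hv
    simp [-extChartAt, show y.1 = x from rfl] at h1
    apply mul_right_cancel₀ h2.ne'
    linear_combination h1

end Product

/-! ### Functions of the first coordinate, and integration of the Hessian. -/

section Profile

variable {n : ℕ} [NeZero n]

theorem smooth_profile {f : EuclideanSpace ℝ (Fin n) → ℝ} (hf : ContDiff ℝ ∞ f) {φ : ℝ → ℝ}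
    (hφ : ∀ x, f x = φ (x 0)) : ContDiff ℝ ∞ φ := by
  have h : φ = fun t => f (t • EuclideanSpace.single 0 1) := by
    ext t
    simp [hφ]
  rw [h]
  exact hf.comp (contDiff_id.smul contDiff_const)

theorem hasFDerivAt_comp_coord {ψ : ℝ → ℝ} (hψ : Differentiable ℝ ψ)
    (x : EuclideanSpace ℝ (Fin n)) :
    HasFDerivAt (fun x : EuclideanSpace ℝ (Fin n) => ψ (x 0))
      (deriv ψ (x 0) • (EuclideanSpace.proj 0 : EuclideanSpace ℝ (Fin n) →L[ℝ] ℝ)) x :=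
  HasDerivAt.comp_hasFDerivAt (f := fun x : EuclideanSpace ℝ (Fin n) => x 0) x
    (hψ (x 0)).hasDerivAt (EuclideanSpace.proj 0 : EuclideanSpace ℝ (Fin n) →L[ℝ] ℝ).hasFDerivAt

/-- Write `x = x₀ e + z` with `z` orthogonal to `e`. The unknown term `c` disappears from every
Hessian entry with `z` as an argument, so the restriction of `h` to the line from `x₀ e` to `x` is
an explicit quadratic. -/
theorem eq_add_sum_of_fderiv_fderiv {h : EuclideanSpace ℝ (Fin n) → ℝ} (hh : ContDiff ℝ ∞ h)
    {ρ : ℝ} {c : EuclideanSpace ℝ (Fin n) → ℝ}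
    (hD : ∀ x v w, fderiv ℝ (fderiv ℝ h) x v w = ρ * inner ℝ v w + c x * (v 0 * w 0))
    (x : EuclideanSpace ℝ (Fin n)) :
    h x = h (x 0 • EuclideanSpace.single 0 1) + ∑ k ∈ Finset.univ.erase (0 : Fin n),
      (ρ / 2 * x k ^ 2 + fderiv ℝ h 0 (EuclideanSpace.single k 1) * x k) := by
  have hne : (∞ : WithTop ℕ∞) ≠ 0 := by simp
  have hd : Differentiable ℝ h := hh.differentiable hne
  have hdd : Differentiable ℝ (fderiv ℝ h) :=
    (hh.fderiv_right (m := ∞) (by simp)).differentiable hne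
  set e : EuclideanSpace ℝ (Fin n) := EuclideanSpace.single 0 1 with he
  set z := x - x 0 • e with hz
  have hz0 : z 0 = 0 := by simp [hz, he]
  have hzk : ∀ k ≠ 0, z k = x k := fun k hk => by simp [hz, he, hk]
  have hline : ∀ (p w : EuclideanSpace ℝ (Fin n)) (s : ℝ),
      HasDerivAt (fun s : ℝ => p + s • w) w s := fun p w s => by
    simpa using ((hasDerivAt_id s).smul_const w).const_add p
  have hgrad : ∀ (p w v : EuclideanSpace ℝ (Fin n)) (s : ℝ),
      HasDerivAt (fun s : ℝ => fderiv ℝ h (p + s • w) v)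
        (fderiv ℝ (fderiv ℝ h) (p + s • w) w v) s := fun p w v s => by
    simpa using ((hdd _).hasFDerivAt.comp_hasDerivAt s (hline p w s)).clm_apply
      (hasDerivAt_const s v)
  have hez : inner ℝ e z = 0 := by simp [he, hz0, EuclideanSpace.inner_single_left]
  -- `Hess h(e, z) = 0`, so the derivative along `z` does not change along the axis and may be taken
  -- at the origin.
  have hconst : fderiv ℝ h (x 0 • e) z = fderiv ℝ h 0 z := by
    have := is_const_of_deriv_eq_zero (fun s => (hgrad 0 e z s).differentiableAt)
      (fun s => by rw [(hgrad 0 e z s).deriv, hD, hez, hz0]; ring) (x 0) 0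
    simpa using this
  have hslope : ∀ s : ℝ, fderiv ℝ h (x 0 • e + s • z) z =
      fderiv ℝ h (x 0 • e) z + ρ * inner ℝ z z * s := by
    intro s
    have h1 : ∀ s, HasDerivAt (fun s : ℝ => fderiv ℝ h (x 0 • e + s • z) z - ρ * inner ℝ z z * s)
        0 s := fun s => by
      have := (hgrad (x 0 • e) z z s).sub ((hasDerivAt_id s).const_mul (ρ * inner ℝ z z))
      rw [hD, hz0] at this
      exact this.congr_deriv (by ring)
    have := is_const_of_deriv_eq_zero (fun s => (h1 s).differentiableAt)
      (fun s => (h1 s).deriv) s 0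
    simp only [zero_smul, add_zero, mul_zero, sub_zero] at this
    linarith
  have hval : h x = h (x 0 • e) + fderiv ℝ h 0 z + ρ / 2 * inner ℝ z z := by
    have h1 : ∀ s, HasDerivAt (fun s : ℝ => h (x 0 • e + s • z) -
        (fderiv ℝ h 0 z * s + ρ / 2 * inner ℝ z z * s ^ 2)) 0 s := fun s => by
      have := ((hd _).hasFDerivAt.comp_hasDerivAt s (hline (x 0 • e) z s)).sub
        (((hasDerivAt_id s).const_mul (fderiv ℝ h 0 z)).add
          ((hasDerivAt_pow 2 s).const_mul (ρ / 2 * inner ℝ z z)))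
      rw [hslope, hconst] at this
      exact this.congr_deriv (by simp; ring)
    have := is_const_of_deriv_eq_zero (fun s => (h1 s).differentiableAt)
      (fun s => (h1 s).deriv) 1 0
    have hx : x 0 • e + z = x := by simp [hz]
    simp [hx] at this
    rw [real_inner_self_eq_norm_sq]
    linarith
  have hzsum : z = ∑ k ∈ Finset.univ.erase (0 : Fin n), x k • EuclideanSpace.single k 1 := by
    ext j
    rcases eq_or_ne j 0 with rfl | hj
    · rw [hz0, WithLp.ofLp_sum, Finset.sum_apply, Finset.sum_eq_zero]
      intro k hk
      simp [(Finset.ne_of_mem_erase hk).symm]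
    · rw [hzk j hj, WithLp.ofLp_sum, Finset.sum_apply, Finset.sum_eq_single_of_mem j (by simp [hj])]
      · simp
      · intro k _ hk
        simp [hk.symm]
  have hinner : inner ℝ z z = ∑ k ∈ Finset.univ.erase (0 : Fin n), x k ^ 2 := by
    rw [PiLp.inner_apply, ← Finset.sum_erase (a := 0) _ (by simp [hz0])]
    refine Finset.sum_congr rfl fun k hk => ?_
    rw [hzk k (Finset.ne_of_mem_erase hk)]
    simp [sq]
  rw [hval, hinner]
  conv_lhs => rw [hzsum]
  rw [map_sum, Finset.mul_sum, add_assoc, ← Finset.sum_add_distrib]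
  congr 1
  refine Finset.sum_congr rfl fun k _ => ?_
  simp
  ring

end Profile

end WarpedSoliton

/-! ### The soliton system for a warping function of one variable. -/

theorem theorem3 {n m : ℕ} [NeZero n] (hn : 2 ≤ n) (hm : 1 ≤ m)
    {F : Type*} [TopologicalSpace F] [Nonempty F]
    [ChartedSpace (EuclideanSpace ℝ (Fin m)) F] [IsManifold (𝓡 m) ∞ F]
    (gF : Bundle.ContMDiffRiemannianMetric (𝓡 m) ∞ (EuclideanSpace ℝ (Fin m))
      (fun q : F => TangentSpace (𝓡 m) q))
    (lam ρ : ℝ) (hF : WarpedSoliton.IsEinstein (𝓡 m) gF.inner lam)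
    (f h : EuclideanSpace ℝ (Fin n) → ℝ) (hf : ContDiff ℝ ∞ f) (hh : ContDiff ℝ ∞ h)
    (hfpos : ∀ x, 0 < f x)
    (hsol : WarpedSoliton.IsGradientRicciSoliton ((𝓡 n).prod (𝓡 m))
      (WarpedSoliton.warpedMetric f gF.inner)
      (fun x : EuclideanSpace ℝ (Fin n) × F => h x.1) ρ)
    (φ : ℝ → ℝ) (hφ : ∀ x, f x = φ (x 0)) :
    ∃ (h₁ : ℝ → ℝ) (a b : Fin n → ℝ), ContDiff ℝ ∞ h₁ ∧
      (∀ x, h x = h₁ (x 0) +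
        ∑ k ∈ Finset.univ.erase (0 : Fin n), (ρ / 2 * x k ^ 2 + a k * x k + b k)) ∧
      (∀ t, lam - φ t * deriv (deriv φ) t - (m - 1) * deriv φ t ^ 2
        + φ t * deriv φ t * deriv h₁ t = ρ * φ t ^ 2) ∧
      (∀ t, φ t * deriv (deriv h₁) t - m * deriv (deriv φ) t = ρ * φ t) := by
  have hne : (∞ : WithTop ℕ∞) ≠ 0 := by simp
  have hφs : ContDiff ℝ ∞ φ := WarpedSoliton.smooth_profile hf hφ
  have hφ1 : Differentiable ℝ φ := hφs.differentiable hne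
  have hφ2 : Differentiable ℝ (deriv φ) :=
    ((contDiff_infty_iff_deriv.1 hφs).2).differentiable hne
  set e : EuclideanSpace ℝ (Fin n) := EuclideanSpace.single 0 1 with he
  have hdf : fderiv ℝ f = fun x =>
      deriv φ (x 0) • (EuclideanSpace.proj 0 : EuclideanSpace ℝ (Fin n) →L[ℝ] ℝ) := by
    ext1 x
    rw [show f = fun x => φ (x 0) from funext hφ]
    exact (WarpedSoliton.hasFDerivAt_comp_coord hφ1 x).fderiv
  have hddf : ∀ x v w, fderiv ℝ (fderiv ℝ f) x v w = deriv (deriv φ) (x 0) * (v 0 * w 0) := by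
    intro x v w
    rw [hdf, ((WarpedSoliton.hasFDerivAt_comp_coord hφ2 x).smul_const _).fderiv]
    simp
    ring
  have hNd : ∀ x : EuclideanSpace ℝ (Fin n), HasFDerivAt
      (fun x : EuclideanSpace ℝ (Fin n) => deriv φ (x 0) • e) _ x := fun x =>
    (WarpedSoliton.hasFDerivAt_comp_coord hφ2 x).smul_const e
  -- The gradient of `f` is `φ'(x₀) e`; its derivative has rank at most one and trace `φ''`.
  have hN : ∀ a u, fderiv ℝ f a u = inner ℝ (deriv φ (a 0) • e) u := by
    intro a u
    simp [hdf, he, inner_smul_left, EuclideanSpace.inner_single_left]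
  have heq := WarpedSoliton.exists_warped_soliton_equations hm gF hF hf hh hfpos hsol hN
    (fun x => (hNd x).differentiableAt)
  have hlin : ∀ t : ℝ, HasDerivAt (fun t : ℝ => t • e) e t := fun t => by
    simpa using (hasDerivAt_id t).smul_const e
  have hh1 : ∀ t : ℝ, HasDerivAt (fun t : ℝ => h (t • e)) (fderiv ℝ h (t • e) e) t := fun t =>
    (hh.differentiable hne _).hasFDerivAt.comp_hasDerivAt t (hlin t)
  have hh2 : ∀ t : ℝ, HasDerivAt (fun t : ℝ => fderiv ℝ h (t • e) e)
      (fderiv ℝ (fderiv ℝ h) (t • e) e e) t := fun t => by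
    simpa using (((hh.fderiv_right (m := ∞) (by simp)).differentiable hne
      _).hasFDerivAt.comp_hasDerivAt t (hlin t)).clm_apply (hasDerivAt_const t e)
  have hderiv : deriv (fun t : ℝ => h (t • e)) = fun t => fderiv ℝ h (t • e) e :=
    funext fun t => (hh1 t).deriv
  have hfe : ∀ t : ℝ, f (t • e) = φ t := fun t => by simp [hφ, he]
  have hte : ∀ t : ℝ, (t • e) 0 = t := fun t => by simp [he]
  -- `h₁` is `h` on the first axis and `a k` are partial derivatives at the origin; all constants
  -- sit in `h₁`, so `b = 0`.
  refine ⟨fun t => h (t • e), fun k => fderiv ℝ h 0 (EuclideanSpace.single k 1), 0,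
    hh.comp (contDiff_id.smul contDiff_const), fun x => ?_, fun t => ?_, fun t => ?_⟩
  · have := WarpedSoliton.eq_add_sum_of_fderiv_fderiv hh
      (c := fun x => m / f x * deriv (deriv φ) (x 0))
      (fun x v w => by rw [(heq x).1, hddf]; ring) x
    simpa using this
  · have h2 := (heq (t • e)).2
    rw [(hNd _).fderiv, hdf, hfe] at h2
    rw [hderiv]
    simp [LinearMap.trace_smulRight, he] at h2 ⊢
    linear_combination h2
  -- The second equation is the `(e, e)` entry of the base equation, multiplied by `φ`.
  · have h1 := (heq (t • e)).1 e e
    rw [hddf, hfe, hte] at h1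
    have hpos : 0 < φ t := hfe t ▸ hfpos _
    rw [hderiv, (hh2 t).deriv, h1]
    simp [he]
    field_simp
    ring
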